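/- Let $m=2d_1\ge 4$ be even, let $n=2d_2+1\ge 3$ be odd, and let $\omega=e^{2\pi\sqrt{-1}/3}$. In $\mathbb{C}^m\otimes\mathbb{C}^n$, with standard bases $|0\rangle,\dots,|m-1\rangle$ of $\mathbb{C}^m$ (Alice, $A$) and $|0\rangle,\dots,|n-1\rangle$ of $\mathbb{C}^n$ (Bob, $B$), consider the following (unnormalized) product states: $$|0\rangle_A\,\big(|2\delta\rangle\pm|2\delta+1\rangle\big)_B,\qquad |m-1\rangle_A\,\big(|2\delta+1\rangle\pm|2\delta+2\rangle\big)_B,$$ $$\Big(\sum_{j=0}^{2}\omega^{tj}|j\rangle\Big)_A|n-1\rangle_B,\qquad \Big(\sum_{j=0}^{2}\omega^{tj}|j+1\rangle\Big)_A|0\rangle_B,$$ $$\big(|2\sigma+3\rangle\pm|2\sigma+4\rangle\big)_A|n-1\rangle_B,\qquad \big(|2\sigma+4\rangle\pm|2\sigma+5\rangle\big)_A|0\rangle_B,$$ where $\delta=0,1,\dots,d_2-1$; $t=0,1,2$; and $\sigma=0,1,\dots,d_1-3$ (no $\sigma$ if $d_1=2$). These are exactly $2(m+n)-4$ distinct,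 pairwise orthogonal, nonzero product states, and the set of them cannot be perfectly distinguished by local operations and classical communication (LOCC): no LOCC protocol between Alice and Bob, with finitely or infinitely many rounds, identifies with probability one which of these states the two parties share, for every state of the set. Here, a protocol with infinitely many rounds is a sequence of protocols with finitely many rounds, each of which continues the one before, and it identifies a state with probability one if the probabilities of announcing that state tend to $1$ along the sequence. -/

import Mathlib

open scoped Kronecker Topology

namespace LOCC

noncomputable section

/-- (Unnormalized) state vectors of `ℂᵃ ⊗ ℂᵇ`, as coordinate vectors in the product basis
`|i⟩_A |j⟩_B`, where `i < a` and `j < b`. -/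
abbrev State (a b : ℕ) : Type := Fin a × Fin b → ℂ

/-- The squared Euclidean norm of a state vector. -/
def normSq {a b : ℕ} (ψ : State a b) : ℝ := ∑ p, ‖ψ p‖ ^ 2

/-- The basis vector `|k⟩` of `ℂᵈ` (used only for `k < d`). -/
def ket (d k : ℕ) : Fin d → ℂ := fun i => if (i : ℕ) = k then 1 else 0

/-- The product vector `|x⟩_A |y⟩_B`. -/
def prodState {a b : ℕ} (x : Fin a → ℂ) (y : Fin b → ℂ) : State a b := fun p => x p.1 * y p.2

/-- A protocol of local operations and classical communication with finitely many rounds, for two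
parties who share a system `ℂᵃ ⊗ ℂᵇ` and who end by announcing a label in `S`.
Either the protocol stops and announces a label, or one of the parties performs a general
measurement on their part, with finitely many outcomes `j` and measurement operators `M j`
satisfying `∑ j, (M j)† (M j) = 1`, and tells the outcome to the other party; the rest of the
protocol depends on that outcome. The measurement operators may change the local dimension, so
that ancillas and the discarding of subsystems are included, and a measurement whose operators
are multiples of unitaries provides local unitaries and randomness. -/
inductive Protocol (S : Type) : ℕ → ℕ → Type
  | announce {a b : ℕ} (s : S) : Protocol S a b
  | alice {a b : ℕ} (r : ℕ) (a' : Fin r → ℕ) (M : ∀ j, Matrix (Fin (a' j)) (Fin a) ℂ)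
      (hM : ∑ j, (M j).conjTranspose * M j = 1) (next : ∀ j, Protocol S (a' j) b) : Protocol S a b
  | bob {a b : ℕ} (r : ℕ) (b' : Fin r → ℕ) (M : ∀ j, Matrix (Fin (b' j)) (Fin b) ℂ)
      (hM : ∑ j, (M j).conjTranspose * M j = 1) (next : ∀ j, Protocol S a (b' j)) : Protocol S a b

open Classical in
/-- The weight with which the protocol announces `s` on the unnormalized input `ψ`: the sum of the
squared norms of the (unnormalized) final states over all branches that end by announcing `s`. -/
def Protocol.weight {S : Type} (s : S) : {a b : ℕ} → Protocol S a b → State a b → ℝ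
  | _, _, .announce s', ψ => if s' = s then normSq ψ else 0
  | _, b, .alice _ _ M _ next, ψ =>
      ∑ j, (next j).weight s ((M j ⊗ₖ (1 : Matrix (Fin b) (Fin b) ℂ)).mulVec ψ)
  | a, _, .bob _ _ M _ next, ψ =>
      ∑ j, (next j).weight s (((1 : Matrix (Fin a) (Fin a) ℂ) ⊗ₖ M j).mulVec ψ)

/-- The probability that the protocol announces `s` when the shared state is `ψ ≠ 0`. -/
def Protocol.prob {S : Type} {a b : ℕ} (P : Protocol S a b) (s : S) (ψ : State a b) : ℝ :=
  P.weight s ψ / normSq ψ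

/-- `P.Extends Q`: the protocol `Q` performs the same measurements as `P`, but where `P` stops,
`Q` may go on with further rounds (and then announce another label). -/
inductive Protocol.Extends {S : Type} : {a b : ℕ} → Protocol S a b → Protocol S a b → Prop
  | announce {a b : ℕ} (s : S) (Q : Protocol S a b) : Protocol.Extends (.announce s) Q
  | alice {a b : ℕ} (r : ℕ) (a' : Fin r → ℕ) (M : ∀ j, Matrix (Fin (a' j)) (Fin a) ℂ)
      (hM : ∑ j, (M j).conjTranspose * M j = 1) (next next' : ∀ j, Protocol S (a' j) b)
      (h : ∀ j, Protocol.Extends (next j) (next' j)) :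
      Protocol.Extends (.alice r a' M hM next) (.alice r a' M hM next')
  | bob {a b : ℕ} (r : ℕ) (b' : Fin r → ℕ) (M : ∀ j, Matrix (Fin (b' j)) (Fin b) ℂ)
      (hM : ∑ j, (M j).conjTranspose * M j = 1) (next next' : ∀ j, Protocol S a (b' j))
      (h : ∀ j, Protocol.Extends (next j) (next' j)) :
      Protocol.Extends (.bob r b' M hM next) (.bob r b' M hM next')

/-- A set `Ω` of (nonzero, not necessarily normalized) states is perfectly distinguishable by LOCC
if some LOCC protocol, with finitely or infinitely many rounds, identifies the state with
probability one, whichever state of `Ω` is shared. A protocol with possibly infinitely many rounds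
is given by its truncations `P 0, P 1, P 2, …`, each extending the one before; a protocol with
finitely many rounds is the case of a constant sequence. -/
def PerfectlyDistinguishable {a b : ℕ} (Ω : Set (State a b)) : Prop :=
  ∃ P : ℕ → Protocol (State a b) a b,
    (∀ k, (P k).Extends (P (k + 1))) ∧
      ∀ ψ ∈ Ω, Filter.Tendsto (fun k => (P k).prob ψ ψ) Filter.atTop (𝓝 1)

/-- The primitive third root of unity `ω = exp (2πi/3)`. -/
def ω : ℂ := Complex.exp (2 * Real.pi * Complex.I / 3)

/-- The vector `∑_{j=0}^{2} ω^{tj} |j + c⟩` of `ℂᵈ`. -/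
def triple (d c t : ℕ) : Fin d → ℂ := ∑ j ∈ Finset.range 3, ω ^ (t * j) • ket d (j + c)

/-- The vector `|k⟩ + s |k + 1⟩` of `ℂᵈ`, where `s` is a sign. -/
def pair (d k : ℕ) (s : ℤˣ) : Fin d → ℂ := ket d k + ((s : ℤ) : ℂ) • ket d (k + 1)

/-- The set of product states in `ℂᵐ ⊗ ℂⁿ`, where `m = 2 d₁` and `n = 2 d₂ + 1`. -/
def mixedStates (m n d₁ d₂ : ℕ) : Set (State m n) :=
  {ψ | ∃ δ < d₂, ∃ s, ψ = prodState (ket m 0) (pair n (2 * δ) s)} ∪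
  {ψ | ∃ t < 3, ψ = prodState (triple m 0 t) (ket n (n - 1))} ∪
  {ψ | ∃ σ, σ + 3 ≤ d₁ ∧ ∃ s, ψ = prodState (pair m (2 * σ + 3) s) (ket n (n - 1))} ∪
  {ψ | ∃ δ < d₂, ∃ s, ψ = prodState (ket m (m - 1)) (pair n (2 * δ + 1) s)} ∪
  {ψ | ∃ t < 3, ψ = prodState (triple m 1 t) (ket n 0)} ∪
  {ψ | ∃ σ, σ + 3 ≤ d₁ ∧ ∃ s, ψ = prodState (pair m (2 * σ + 4) s) (ket n 0)}

end

end LOCC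

/-! The obstruction is local stability: an operator on one side that keeps all the states mutually
orthogonal must be a scalar (`LocallyStable`). A useful local measurement must keep the states
orthogonal, so here every measurement operator satisfies `Mᴴ * M = c • 1` and reveals nothing.

For infinitely many rounds, the argument is run on a fixed truncation, whose later extensions have
error tending to zero. The error of a branch is bounded by the total error (`tendsto_branch`), so
the unnormalized states in each branch are identified with arbitrarily small error by the
continuations. Such states are exactly orthogonal (`Protocol.norm_dotProduct_le_weight`,
`Protocol.dotProduct_eq_zero_of_tendsto`). By induction every branch operator is `V ⊗ₖ W` with
scalar `Vᴴ * V` and `Wᴴ * W`, so each truncation announces each label with a probability independent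
of the state (`LocallyStable.weight_eq`). The success probabilities of two distinct states then add
up to at most 1, and cannot both tend to 1.

Stability comes from the tiling of the border of the `m × n` grid by two columns and two rows, each
omitting one extreme level. The tiles of one column split the levels into blocks, and those of the
other do so after a shift by one. Orthogonality between tiles kills off-diagonal entries, and
orthogonality inside a tile equates diagonal entries. Only Alice's levels 1 and 2 share a block in
both columns; there the Fourier relations of the triple finish the argument (`form_ket_of_triple`).
-/

namespace LOCC
open Matrix

/-! ### Norms, inner products and completeness of local measurements. -/

section Measurement

variable {ι : Type*} [Fintype ι]

theorem normSq_eq {a b : ℕ} (ψ : State a b) : normSq ψ = (star ψ ⬝ᵥ ψ).re := by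
  simp [normSq, dotProduct, ← Complex.normSq_eq_norm_sq, Complex.normSq_apply]

theorem normSq_nonneg {a b : ℕ} (ψ : State a b) : 0 ≤ normSq ψ :=
  Finset.sum_nonneg fun _ _ => by positivity

theorem normSq_pos {a b : ℕ} {ψ : State a b} (h : ψ ≠ 0) : 0 < normSq ψ := by
  obtain ⟨p, hp⟩ := Function.ne_iff.1 h
  refine Finset.sum_pos' (fun _ _ => by positivity) ⟨p, Finset.mem_univ _, ?_⟩
  have : ψ p ≠ 0 := hp
  positivity

theorem norm_dotProduct_le {a b : ℕ} (ψ φ : State a b) :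
    ‖star ψ ⬝ᵥ φ‖ ≤ √(normSq ψ) * √(normSq φ) := by
  calc ‖star ψ ⬝ᵥ φ‖ ≤ ∑ p, ‖ψ p‖ * ‖φ p‖ := by
        refine (norm_sum_le _ _).trans_eq ?_
        simp
    _ ≤ _ := Real.sum_mul_le_sqrt_mul_sqrt _ _ _

theorem star_mulVec_dotProduct {l k : Type*} [Fintype l] [Fintype k] (A B : Matrix l k ℂ)
    (x y : k → ℂ) : star (A *ᵥ x) ⬝ᵥ (B *ᵥ y) = star x ⬝ᵥ ((Aᴴ * B) *ᵥ y) := by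
  rw [star_mulVec, ← dotProduct_mulVec, mulVec_mulVec]

variable {a b : ℕ} {c d : ι → ℕ} {K : ∀ j, Matrix (Fin (c j) × Fin (d j)) (Fin a × Fin b) ℂ}

theorem sum_dotProduct_mulVec (hK : ∑ j, (K j)ᴴ * K j = 1) (ψ φ : State a b) :
    ∑ j, star (K j *ᵥ ψ) ⬝ᵥ (K j *ᵥ φ) = star ψ ⬝ᵥ φ := by
  simp_rw [star_mulVec_dotProduct]
  rw [← dotProduct_sum, ← sum_mulVec, hK, one_mulVec]

theorem sum_normSq_mulVec (hK : ∑ j, (K j)ᴴ * K j = 1) (ψ : State a b) :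
    ∑ j, normSq (K j *ᵥ ψ) = normSq ψ := by
  simp_rw [normSq_eq]
  rw [← Complex.re_sum, sum_dotProduct_mulVec hK]

theorem sum_kronecker_one {a b : ℕ} {c : ι → ℕ} {M : ∀ j, Matrix (Fin (c j)) (Fin a) ℂ}
    (hM : ∑ j, (M j)ᴴ * M j = 1) :
    ∑ j, (M j ⊗ₖ (1 : Matrix (Fin b) (Fin b) ℂ))ᴴ * (M j ⊗ₖ (1 : Matrix (Fin b) (Fin b) ℂ)) = 1 := by
  have : ∀ j, (M j ⊗ₖ (1 : Matrix (Fin b) (Fin b) ℂ))ᴴ * (M j ⊗ₖ (1 : Matrix (Fin b) (Fin b) ℂ))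
      = ((M j)ᴴ * M j) ⊗ₖ 1 := fun j => by
    rw [conjTranspose_kronecker, ← mul_kronecker_mul]; simp
  simp_rw [this]
  rw [← one_kronecker_one, ← hM]
  ext p q
  simp [Matrix.sum_apply, Finset.sum_mul]

theorem sum_one_kronecker {a b : ℕ} {d : ι → ℕ} {M : ∀ j, Matrix (Fin (d j)) (Fin b) ℂ}
    (hM : ∑ j, (M j)ᴴ * M j = 1) :
    ∑ j, ((1 : Matrix (Fin a) (Fin a) ℂ) ⊗ₖ M j)ᴴ * ((1 : Matrix (Fin a) (Fin a) ℂ) ⊗ₖ M j) = 1 := by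
  have : ∀ j, ((1 : Matrix (Fin a) (Fin a) ℂ) ⊗ₖ M j)ᴴ * ((1 : Matrix (Fin a) (Fin a) ℂ) ⊗ₖ M j)
      = 1 ⊗ₖ ((M j)ᴴ * M j) := fun j => by
    rw [conjTranspose_kronecker, ← mul_kronecker_mul]; simp
  simp_rw [this]
  rw [← one_kronecker_one, ← hM]
  ext p q
  simp [Matrix.sum_apply, Finset.mul_sum]

end Measurement

/-! ### Announcement weights, the error estimate, and extension of protocols. -/

namespace Protocol

variable {S : Type}

theorem weight_nonneg (s : S) {a b : ℕ} (P : Protocol S a b) (ψ : State a b) :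
    0 ≤ P.weight s ψ := by
  induction P with
  | announce s' =>
    rw [weight]
    split_ifs
    exacts [normSq_nonneg ψ, le_rfl]
  | alice r a' M hM next ih => exact Finset.sum_nonneg fun j _ => ih j _
  | bob r b' M hM next ih => exact Finset.sum_nonneg fun j _ => ih j _

theorem weight_add_le {s s' : S} (h : s ≠ s') {a b : ℕ} (P : Protocol S a b) (ψ : State a b) :
    P.weight s ψ + P.weight s' ψ ≤ normSq ψ := by
  induction P with
  | announce u =>
    have := normSq_nonneg ψ
    simp only [weight]
    split_ifs with h1 h2
    · exact absurd (h1.symm.trans h2) h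
    all_goals simp [this]
  | alice r a' M hM next ih =>
    rw [weight, weight, ← Finset.sum_add_distrib, ← sum_normSq_mulVec (sum_kronecker_one hM)]
    exact Finset.sum_le_sum fun j _ => ih j _
  | bob r b' M hM next ih =>
    rw [weight, weight, ← Finset.sum_add_distrib, ← sum_normSq_mulVec (sum_one_kronecker hM)]
    exact Finset.sum_le_sum fun j _ => ih j _

theorem weight_le (s : S) {a b : ℕ} (P : Protocol S a b) (ψ : State a b) :
    P.weight s ψ ≤ normSq ψ := by
  induction P with
  | announce u =>
    have := normSq_nonneg ψ
    simp only [weight]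
    split_ifs
    exacts [le_rfl, this]
  | alice r a' M hM next ih =>
    rw [weight, ← sum_normSq_mulVec (sum_kronecker_one hM)]
    exact Finset.sum_le_sum fun j _ => ih j _
  | bob r b' M hM next ih =>
    rw [weight, ← sum_normSq_mulVec (sum_one_kronecker hM)]
    exact Finset.sum_le_sum fun j _ => ih j _

/-- The step of `norm_dotProduct_le_weight`: the estimate passes from the branches of a measurement
to the whole measurement. -/
theorem norm_dotProduct_le_of_branches {ι : Type*} [Fintype ι] {a b : ℕ} {c d : ι → ℕ}
    {K : ∀ j, Matrix (Fin (c j) × Fin (d j)) (Fin a × Fin b) ℂ} (hK : ∑ j, (K j)ᴴ * K j = 1)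
    (s : S) (P : ∀ j, Protocol S (c j) (d j)) (ψ φ : State a b)
    (h : ∀ j, ‖star (K j *ᵥ ψ) ⬝ᵥ (K j *ᵥ φ)‖ ≤
      √(normSq (K j *ᵥ ψ) - (P j).weight s (K j *ᵥ ψ)) * √(normSq (K j *ᵥ φ)) +
        √(normSq (K j *ᵥ ψ)) * √((P j).weight s (K j *ᵥ φ))) :
    ‖star ψ ⬝ᵥ φ‖ ≤ √(normSq ψ - ∑ j, (P j).weight s (K j *ᵥ ψ)) * √(normSq φ) +
        √(normSq ψ) * √(∑ j, (P j).weight s (K j *ᵥ φ)) := by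
  rw [← sum_dotProduct_mulVec hK, ← sum_normSq_mulVec hK, ← sum_normSq_mulVec hK,
    ← Finset.sum_sub_distrib]
  refine (norm_sum_le _ _).trans ((Finset.sum_le_sum fun j _ => h j).trans ?_)
  rw [Finset.sum_add_distrib]
  refine add_le_add ?_ ?_
  · exact Real.sum_sqrt_mul_sqrt_le _ (fun j => sub_nonneg.2 (weight_le s _ _))
      (fun j => normSq_nonneg _)
  · exact Real.sum_sqrt_mul_sqrt_le _ (fun j => normSq_nonneg _) (fun j => weight_nonneg s _ _)

/-- The inner product is a sum over final branches. Those announcing `s` see little of `φ` when `s`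
is rarely announced on `φ`, and the others see little of `ψ` when `s` is nearly always announced on
`ψ`; Cauchy–Schwarz bounds each part. -/
theorem norm_dotProduct_le_weight (s : S) {a b : ℕ} (P : Protocol S a b) (ψ φ : State a b) :
    ‖star ψ ⬝ᵥ φ‖ ≤ √(normSq ψ - P.weight s ψ) * √(normSq φ) + √(normSq ψ) * √(P.weight s φ) := by
  induction P with
  | announce u =>
    simp only [weight]
    split_ifs <;> simp [norm_dotProduct_le ψ φ]
  | alice r a' M hM next ih =>
    exact norm_dotProduct_le_of_branches (sum_kronecker_one hM) s next ψ φ fun j => ih j _ _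
  | bob r b' M hM next ih =>
    exact norm_dotProduct_le_of_branches (sum_one_kronecker hM) s next ψ φ fun j => ih j _ _

/-- States that a sequence of protocols identifies with arbitrarily small error are orthogonal. -/
theorem dotProduct_eq_zero_of_tendsto {s s' : S} (h : s ≠ s') {a b : ℕ} (Q : ℕ → Protocol S a b)
    {ψ φ : State a b}
    (hψ : Filter.Tendsto (fun k => normSq ψ - (Q k).weight s ψ) Filter.atTop (𝓝 0))
    (hφ : Filter.Tendsto (fun k => normSq φ - (Q k).weight s' φ) Filter.atTop (𝓝 0)) :
    star ψ ⬝ᵥ φ = 0 := by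
  -- On `φ` the label `s` competes with `s'`, so its weight is at most the error on `φ`.
  have hφ' : Filter.Tendsto (fun k => (Q k).weight s φ) Filter.atTop (𝓝 0) :=
    squeeze_zero (fun k => weight_nonneg s _ _)
      (fun k => by have := weight_add_le h (Q k) φ; linarith) hφ
  have key : Filter.Tendsto (fun k => √(normSq ψ - (Q k).weight s ψ) * √(normSq φ) +
      √(normSq ψ) * √((Q k).weight s φ)) Filter.atTop (𝓝 (√0 * √(normSq φ) + √(normSq ψ) * √0)) :=
    (hψ.sqrt.mul_const _).add (hφ'.sqrt.const_mul _)
  simp only [Real.sqrt_zero, zero_mul, mul_zero, add_zero] at key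
  exact norm_le_zero_iff.1 (ge_of_tendsto' key fun k => norm_dotProduct_le_weight s (Q k) ψ φ)

theorem Extends.refl {a b : ℕ} (P : Protocol S a b) : P.Extends P := by
  induction P with
  | announce s => exact .announce _ _
  | alice r a' M hM next ih => exact .alice _ _ _ _ _ _ ih
  | bob r a' M hM next ih => exact .bob _ _ _ _ _ _ ih

theorem Extends.alice_inv {a b r : ℕ} {a' : Fin r → ℕ} {M : ∀ j, Matrix (Fin (a' j)) (Fin a) ℂ}
    {hM : ∑ j, (M j)ᴴ * M j = 1} {next : ∀ j, Protocol S (a' j) b} {Q : Protocol S a b}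
    (h : Extends (.alice r a' M hM next) Q) :
    ∃ next', Q = .alice r a' M hM next' ∧ ∀ j, (next j).Extends (next' j) := by
  cases h with
  | alice _ _ _ _ _ next' h => exact ⟨next', rfl, h⟩

theorem Extends.bob_inv {a b r : ℕ} {b' : Fin r → ℕ} {M : ∀ j, Matrix (Fin (b' j)) (Fin b) ℂ}
    {hM : ∑ j, (M j)ᴴ * M j = 1} {next : ∀ j, Protocol S a (b' j)} {Q : Protocol S a b}
    (h : Extends (.bob r b' M hM next) Q) :
    ∃ next', Q = .bob r b' M hM next' ∧ ∀ j, (next j).Extends (next' j) := by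
  cases h with
  | bob _ _ _ _ _ next' h => exact ⟨next', rfl, h⟩

theorem Extends.trans {a b : ℕ} {P Q R : Protocol S a b} (h : P.Extends Q) (h' : Q.Extends R) :
    P.Extends R := by
  induction h with
  | announce s Q => exact .announce _ _
  | alice r a' M hM next next' h ih =>
    obtain ⟨next'', rfl, h''⟩ := h'.alice_inv
    exact .alice _ _ _ _ _ _ fun j => ih j (h'' j)
  | bob r a' M hM next next' h ih =>
    obtain ⟨next'', rfl, h''⟩ := h'.bob_inv
    exact .bob _ _ _ _ _ _ fun j => ih j (h'' j)

end Protocol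

/-! ### Local stability excludes perfect discrimination. -/

theorem normSq_kronecker_mulVec {a b a' b' : ℕ} {V : Matrix (Fin a') (Fin a) ℂ}
    {W : Matrix (Fin b') (Fin b) ℂ} {v w : ℂ} (hV : Vᴴ * V = v • 1) (hW : Wᴴ * W = w • 1)
    (ψ : State a b) : normSq ((V ⊗ₖ W) *ᵥ ψ) = (v * w).re * normSq ψ := by
  have h0 : (star ψ ⬝ᵥ ψ).im = 0 := by
    simp [dotProduct, mul_comm]
  rw [normSq_eq, normSq_eq, star_mulVec_dotProduct, conjTranspose_kronecker, ← mul_kronecker_mul,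
    hV, hW, smul_kronecker, kronecker_smul, one_kronecker_one, smul_smul, smul_mulVec, one_mulVec,
    dotProduct_smul, smul_eq_mul, Complex.mul_re, h0, mul_zero, sub_zero]

/-- Error of the branch `j` is at most the error of the whole measurement. -/
theorem tendsto_branch {S ι : Type} [Fintype ι] {a b : ℕ} {c d : ι → ℕ}
    {K : ∀ j, Matrix (Fin (c j) × Fin (d j)) (Fin a × Fin b) ℂ} (hK : ∑ j, (K j)ᴴ * K j = 1)
    (s : S) (Q : ℕ → ∀ j, Protocol S (c j) (d j)) (ψ : State a b)
    (h : Filter.Tendsto (fun k => normSq ψ - ∑ j, (Q k j).weight s (K j *ᵥ ψ))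
      Filter.atTop (𝓝 0)) (j : ι) :
    Filter.Tendsto (fun k => normSq (K j *ᵥ ψ) - (Q k j).weight s (K j *ᵥ ψ))
      Filter.atTop (𝓝 0) := by
  refine squeeze_zero (fun k => sub_nonneg.2 (Protocol.weight_le s _ _)) (fun k => ?_) h
  rw [← sum_normSq_mulVec hK ψ, ← Finset.sum_sub_distrib]
  exact Finset.single_le_sum (f := fun j => normSq (K j *ᵥ ψ) - (Q k j).weight s (K j *ᵥ ψ))
    (fun i _ => sub_nonneg.2 (Protocol.weight_le s _ _)) (Finset.mem_univ j)

/-- The set `Ω` is locally stable: the only operators on one of the two sides that keep the states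
of `Ω` orthogonal are the scalars. -/
structure LocallyStable {a b : ℕ} (Ω : Set (State a b)) : Prop where
  alice : ∀ E : Matrix (Fin a) (Fin a) ℂ, (Ω.Pairwise fun ψ φ =>
    star ψ ⬝ᵥ ((E ⊗ₖ (1 : Matrix (Fin b) (Fin b) ℂ)) *ᵥ φ) = 0) → ∃ c : ℂ, E = c • 1
  bob : ∀ E : Matrix (Fin b) (Fin b) ℂ, (Ω.Pairwise fun ψ φ =>
    star ψ ⬝ᵥ (((1 : Matrix (Fin a) (Fin a) ℂ) ⊗ₖ E) *ᵥ φ) = 0) → ∃ c : ℂ, E = c • 1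

namespace LocallyStable

variable {a b : ℕ} {Ω : Set (State a b)}

/-- `V ⊗ₖ W` is the operator accumulated on the way to the current node. The error hypothesis
concerns the extensions `Q k`, the conclusion only their common initial part `P`, which allows
induction on the finite tree `P`. -/
theorem weight_eq (hΩ : LocallyStable Ω) {a' b' : ℕ} (P : Protocol (State a b) a' b') :
    ∀ (V : Matrix (Fin a') (Fin a) ℂ) (W : Matrix (Fin b') (Fin b) ℂ) (v w : ℂ)
      (_ : Vᴴ * V = v • 1) (_ : Wᴴ * W = w • 1) (Q : ℕ → Protocol (State a b) a' b')
      (_ : ∀ k, P.Extends (Q k)) (_ : ∀ ψ ∈ Ω, Filter.Tendsto (fun k => normSq ((V ⊗ₖ W) *ᵥ ψ) -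
        (Q k).weight ψ ((V ⊗ₖ W) *ᵥ ψ)) Filter.atTop (𝓝 0)) (s : State a b),
      ∃ κ : ℝ, ∀ ψ, P.weight s ((V ⊗ₖ W) *ᵥ ψ) = κ * normSq ψ := by
  induction P with
  | announce u =>
    intro V W v w hV hW Q _ _ s
    simp only [Protocol.weight]
    split_ifs
    · exact ⟨_, normSq_kronecker_mulVec hV hW⟩
    · exact ⟨0, by simp⟩
  | @alice a' b' r c M hM next ih =>
    intro V W v w hV hW Q hQ hlim s
    choose next' hQ' hnext using fun k => (hQ k).alice_inv
    -- A zero factor means the branch is never reached; otherwise `w` can be cancelled to isolate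
    -- the condition on Alice's operator.
    by_cases hw : w = 0
    · refine ⟨0, fun ψ => le_antisymm ?_ ?_⟩
      · refine (Protocol.weight_le _ _ _).trans_eq ?_
        rw [normSq_kronecker_mulVec hV hW, hw]; simp
      · rw [zero_mul]; exact Protocol.weight_nonneg _ _ _
    have hcomp : ∀ (j) (ψ : State a b), (M j ⊗ₖ (1 : Matrix (Fin b') (Fin b') ℂ)) *ᵥ
        ((V ⊗ₖ W) *ᵥ ψ) = ((M j * V) ⊗ₖ W) *ᵥ ψ := fun j ψ => by
      rw [mulVec_mulVec, ← mul_kronecker_mul, Matrix.one_mul]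
    have hlim' : ∀ j, ∀ ψ ∈ Ω, Filter.Tendsto (fun k => normSq (((M j * V) ⊗ₖ W) *ᵥ ψ) -
        (next' k j).weight ψ (((M j * V) ⊗ₖ W) *ᵥ ψ)) Filter.atTop (𝓝 0) := fun j ψ hψ => by
      have := tendsto_branch (sum_kronecker_one hM) ψ next' ((V ⊗ₖ W) *ᵥ ψ)
        (by simpa only [hQ', Protocol.weight] using hlim ψ hψ) j
      simpa only [hcomp] using this
    have hE : ∀ j, ∃ e : ℂ, (M j * V)ᴴ * (M j * V) = e • 1 := fun j => by
      refine hΩ.alice _ fun ψ hψ φ hφ hne => ?_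
      have h := Protocol.dotProduct_eq_zero_of_tendsto hne (fun k => next' k j)
        (hlim' j ψ hψ) (hlim' j φ hφ)
      rw [star_mulVec_dotProduct, conjTranspose_kronecker, ← mul_kronecker_mul, hW,
        kronecker_smul, smul_mulVec, dotProduct_smul, smul_eq_mul] at h
      exact (mul_eq_zero.1 h).resolve_left hw
    choose e he using hE
    choose κ hκ using fun j => ih j (M j * V) W (e j) w (he j) hW (fun k => next' k j)
      (fun k => hnext k j) (hlim' j) s
    refine ⟨∑ j, κ j, fun ψ => ?_⟩
    simp only [Protocol.weight, hcomp, hκ, Finset.sum_mul]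
  | @bob a' b' r c M hM next ih =>
    intro V W v w hV hW Q hQ hlim s
    choose next' hQ' hnext using fun k => (hQ k).bob_inv
    by_cases hv : v = 0
    · refine ⟨0, fun ψ => le_antisymm ?_ ?_⟩
      · refine (Protocol.weight_le _ _ _).trans_eq ?_
        rw [normSq_kronecker_mulVec hV hW, hv]; simp
      · rw [zero_mul]; exact Protocol.weight_nonneg _ _ _
    have hcomp : ∀ (j) (ψ : State a b), ((1 : Matrix (Fin a') (Fin a') ℂ) ⊗ₖ M j) *ᵥ
        ((V ⊗ₖ W) *ᵥ ψ) = (V ⊗ₖ (M j * W)) *ᵥ ψ := fun j ψ => by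
      rw [mulVec_mulVec, ← mul_kronecker_mul, Matrix.one_mul]
    have hlim' : ∀ j, ∀ ψ ∈ Ω, Filter.Tendsto (fun k => normSq ((V ⊗ₖ (M j * W)) *ᵥ ψ) -
        (next' k j).weight ψ ((V ⊗ₖ (M j * W)) *ᵥ ψ)) Filter.atTop (𝓝 0) := fun j ψ hψ => by
      have := tendsto_branch (sum_one_kronecker hM) ψ next' ((V ⊗ₖ W) *ᵥ ψ)
        (by simpa only [hQ', Protocol.weight] using hlim ψ hψ) j
      simpa only [hcomp] using this
    have hE : ∀ j, ∃ e : ℂ, (M j * W)ᴴ * (M j * W) = e • 1 := fun j => by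
      refine hΩ.bob _ fun ψ hψ φ hφ hne => ?_
      have h := Protocol.dotProduct_eq_zero_of_tendsto hne (fun k => next' k j)
        (hlim' j ψ hψ) (hlim' j φ hφ)
      rw [star_mulVec_dotProduct, conjTranspose_kronecker, ← mul_kronecker_mul, hV,
        smul_kronecker, smul_mulVec, dotProduct_smul, smul_eq_mul] at h
      exact (mul_eq_zero.1 h).resolve_left hv
    choose e he using hE
    choose κ hκ using fun j => ih j V (M j * W) v (e j) hV (he j) (fun k => next' k j)
      (fun k => hnext k j) (hlim' j) s
    refine ⟨∑ j, κ j, fun ψ => ?_⟩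
    simp only [Protocol.weight, hcomp, hκ, Finset.sum_mul]

theorem not_perfectlyDistinguishable (hΩ : LocallyStable Ω) (hne : ∀ ψ ∈ Ω, ψ ≠ 0)
    (hnt : Ω.Nontrivial) : ¬ PerfectlyDistinguishable Ω := by
  rintro ⟨P, hP, hlim⟩
  have hext : ∀ k l, (P k).Extends (P (k + l)) := fun k l => by
    induction l with
    | zero => exact .refl _
    | succ l ih => exact ih.trans (hP _)
  have hweight : ∀ ψ ∈ Ω, Filter.Tendsto (fun k => normSq ψ - (P k).weight ψ ψ)
      Filter.atTop (𝓝 0) := fun ψ hψ => by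
    have h0 := (normSq_pos (hne ψ hψ)).ne'
    have := ((hlim ψ hψ).const_sub 1).mul_const (normSq ψ)
    simpa [Protocol.prob, sub_mul, div_mul_cancel₀ _ h0] using this
  obtain ⟨ψ, hψ, φ, hφ, hψφ⟩ := hnt
  -- At the root nothing has been measured, so `V = W = 1`; the tail of the sequence from `k` on
  -- supplies the extensions.
  have hκ : ∀ k s, ∃ κ : ℝ, ∀ ψ, (P k).weight s ψ = κ * normSq ψ := fun k s => by
    have := hΩ.weight_eq (P k) 1 1 1 1 (by simp) (by simp) (fun l => P (k + l)) (hext k)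
      (fun ψ hψ => by
        simpa [add_comm k] using (Filter.tendsto_add_atTop_iff_nat k).2 (hweight ψ hψ)) s
    simpa using this
  have hsum : ∀ k, (P k).prob ψ ψ + (P k).prob φ φ ≤ 1 := fun k => by
    obtain ⟨κ, h⟩ := hκ k ψ
    obtain ⟨κ', h'⟩ := hκ k φ
    have h1 := normSq_pos (hne ψ hψ)
    have h2 := normSq_pos (hne φ hφ)
    have := (P k).weight_add_le hψφ ψ
    rw [h, h', ← add_mul] at this
    rw [Protocol.prob, Protocol.prob, h, h', mul_div_cancel_right₀ _ h1.ne',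
      mul_div_cancel_right₀ _ h2.ne']
    nlinarith
  have := le_of_tendsto' ((hlim ψ hψ).add (hlim φ hφ)) hsum
  norm_num at this

end LocallyStable

/-! ### The cube root of unity and sesquilinear forms on basis vectors. -/

theorem omega_pow_three : ω ^ 3 = 1 := by
  have := (Complex.isPrimitiveRoot_exp 3 (by norm_num)).pow_eq_one
  simpa [ω] using this

theorem one_add_omega_add_sq : 1 + ω + ω ^ 2 = 0 := by
  have h := (Complex.isPrimitiveRoot_exp 3 (by norm_num)).geom_sum_eq_zero (by norm_num)
  simpa [ω, Finset.sum_range_succ] using h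

theorem star_omega : star ω = ω ^ 2 := by
  have h1 : star ω * ω = 1 := by
    have : ‖ω‖ = 1 := by
      have := (Complex.isPrimitiveRoot_exp 3 (by norm_num)).norm'_eq_one (by norm_num)
      simpa [ω] using this
    rw [Complex.star_def, ← Complex.normSq_eq_conj_mul_self, Complex.normSq_eq_norm_sq, this]
    simp
  calc star ω = star ω * ω ^ 3 := by rw [omega_pow_three, mul_one]
    _ = star ω * ω * ω ^ 2 := by ring
    _ = ω ^ 2 := by rw [h1, one_mul]

/-- The sesquilinear form `⟨x|E|y⟩`. -/
noncomputable def form {d : ℕ} (E : Matrix (Fin d) (Fin d) ℂ) (x y : Fin d → ℂ) : ℂ :=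
  star x ⬝ᵥ (E *ᵥ y)

section Form

variable {d : ℕ} (E : Matrix (Fin d) (Fin d) ℂ) (x y z : Fin d → ℂ) (r : ℂ)

@[simp] theorem form_zero_left : form E 0 y = 0 := by simp [form]

@[simp] theorem form_zero_right : form E x 0 = 0 := by simp [form]

@[simp] theorem form_add_left : form E (x + y) z = form E x z + form E y z := by
  simp [form, add_dotProduct]

@[simp] theorem form_add_right : form E x (y + z) = form E x y + form E x z := by
  simp [form, mulVec_add]

@[simp] theorem form_smul_left : form E (r • x) y = star r * form E x y := by
  simp [form]

@[simp] theorem form_smul_right : form E x (r • y) = r * form E x y := by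
  simp [form, mulVec_smul]

theorem form_eq_zero_of_mem_span {s t : Set (Fin d → ℂ)} (h : ∀ x ∈ s, ∀ y ∈ t, form E x y = 0)
    {x y : Fin d → ℂ} (hx : x ∈ Submodule.span ℂ s) (hy : y ∈ Submodule.span ℂ t) :
    form E x y = 0 := by
  induction hx using Submodule.span_induction with
  | mem x hx =>
    induction hy using Submodule.span_induction with
    | mem y hy => exact h x hx y hy
    | zero => simp
    | add _ _ _ _ h1 h2 => simp [h1, h2]
    | smul _ _ _ h1 => simp [h1]
  | zero => simp
  | add _ _ _ _ h1 h2 => simp [h1, h2]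
  | smul _ _ _ h1 => simp [h1]

theorem ket_eq_single {i : ℕ} (hi : i < d) : ket d i = Pi.single ⟨i, hi⟩ 1 := by
  ext k
  simp [ket, Pi.single_apply, Fin.ext_iff]

theorem form_ket {i j : ℕ} (hi : i < d) (hj : j < d) :
    form E (ket d i) (ket d j) = E ⟨i, hi⟩ ⟨j, hj⟩ := by
  have : star (Pi.single ⟨i, hi⟩ 1 : Fin d → ℂ) = Pi.single ⟨i, hi⟩ 1 := by
    ext k
    by_cases h : k = ⟨i, hi⟩ <;> simp [h]
  rw [form, ket_eq_single hi, ket_eq_single hj, this]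
  simp

theorem form_one_ket {i j : ℕ} (hi : i < d) (hj : j < d) :
    form 1 (ket d i) (ket d j) = if i = j then 1 else 0 := by
  rw [form_ket _ hi hj, one_apply]
  simp

theorem form_one_comm : form 1 y x = star (form 1 x y) := by
  simp [form, dotProduct, mul_comm]

theorem eq_smul_one_of_form_ket (h : ∀ i < d, ∀ j < d, i ≠ j → form E (ket d i) (ket d j) = 0)
    (h' : ∀ i, i + 1 < d → form E (ket d i) (ket d i) = form E (ket d (i + 1)) (ket d (i + 1))) :
    ∃ c : ℂ, E = c • 1 := by
  have hd : ∀ i < d, form E (ket d i) (ket d i) = form E (ket d 0) (ket d 0) := by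
    intro i hi
    induction i with
    | zero => rfl
    | succ i ih => rw [← h' i hi, ih (by omega)]
  refine ⟨form E (ket d 0) (ket d 0), ?_⟩
  ext ⟨i, hi⟩ ⟨j, hj⟩
  rw [← form_ket E hi hj]
  rcases eq_or_ne i j with rfl | hij
  · simp [hd i hi]
  · simp [h i hi j hj hij, hij]

end Form

theorem form_kronecker {a b : ℕ} (E : Matrix (Fin a) (Fin a) ℂ) (F : Matrix (Fin b) (Fin b) ℂ)
    (x x' : Fin a → ℂ) (y y' : Fin b → ℂ) :
    star (prodState x y) ⬝ᵥ ((E ⊗ₖ F) *ᵥ prodState x' y') = form E x x' * form F y y' := by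
  have : (E ⊗ₖ F) *ᵥ prodState x' y' = prodState (E *ᵥ x') (F *ᵥ y') := by
    ext p
    simp only [mulVec, dotProduct, prodState, Fintype.sum_prod_type, Finset.sum_mul_sum,
      kroneckerMap_apply]
    exact Finset.sum_congr rfl fun i _ => Finset.sum_congr rfl fun j _ => by ring
  rw [this]
  simp only [form, dotProduct, Fintype.sum_prod_type, Finset.sum_mul_sum, prodState, Pi.star_apply,
    star_mul']
  exact Finset.sum_congr rfl fun i _ => Finset.sum_congr rfl fun j _ => by ring

/-! ### Basis vectors recovered from tiles, and indexing of the states. -/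

theorem triple_eq (d c t : ℕ) :
    triple d c t = ket d c + ω ^ t • ket d (c + 1) + (ω ^ t) ^ 2 • ket d (c + 2) := by
  simp [triple, Finset.sum_range_succ, add_comm, pow_mul]

theorem ket_mem_span_triple (d c j : ℕ) (hj : j < 3) :
    ket d (c + j) ∈ Submodule.span ℂ {x | ∃ t < 3, x = triple d c t} := by
  have h := one_add_omega_add_sq
  have h3 : ∀ t < 3, triple d c t ∈ Submodule.span ℂ {x | ∃ t < 3, x = triple d c t} :=
    fun t ht => Submodule.subset_span ⟨t, ht, rfl⟩
  -- Inverse Fourier transform on three levels; `ω ^ (2 * j)` and `ω ^ j` are the inverses of `ω ^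
  -- j` and `ω ^ (2 * j)`.
  have : ket d (c + j) = (1 / 3 : ℂ) • triple d c 0 + ((1 / 3 : ℂ) * ω ^ (2 * j)) • triple d c 1 +
      ((1 / 3 : ℂ) * ω ^ j) • triple d c 2 := by
    simp only [triple_eq]
    interval_cases j <;> try simp only [add_zero]
    all_goals match_scalars <;> grind
  rw [this]
  exact add_mem (add_mem (Submodule.smul_mem _ _ (h3 0 (by norm_num)))
    (Submodule.smul_mem _ _ (h3 1 (by norm_num)))) (Submodule.smul_mem _ _ (h3 2 (by norm_num)))

theorem ket_mem_span_pair (d k j : ℕ) (hj : j < 2) :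
    ket d (k + j) ∈ Submodule.span ℂ (Set.range (pair d k)) := by
  have : ket d (k + j) = (1 / 2 : ℂ) • pair d k 1 + ((1 / 2 : ℂ) * (-1) ^ j) • pair d k (-1) := by
    simp only [pair]
    interval_cases j <;> try simp only [add_zero]
    all_goals match_scalars <;> norm_num
  rw [this]
  exact add_mem (Submodule.smul_mem _ _ (Submodule.subset_span ⟨_, rfl⟩))
    (Submodule.smul_mem _ _ (Submodule.subset_span ⟨_, rfl⟩))

/-- Indices of the states in one of the two outer columns. -/
abbrev ColIdx (d₁ : ℕ) : Type := Fin 3 ⊕ Fin (d₁ - 2) × ℤˣ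

/-- Indices of the states in one of the two outer rows. -/
abbrev RowIdx (d₂ : ℕ) : Type := Fin d₂ × ℤˣ

/-- The Alice parts of the states in a column, shifted by one level if `c` is true. -/
noncomputable def col (m : ℕ) {d₁ : ℕ} (c : Bool) : ColIdx d₁ → Fin m → ℂ
  | .inl t => triple m c.toNat t
  | .inr (σ, s) => pair m (2 * σ + 3 + c.toNat) s

/-- The Bob parts of the states in a row, shifted by one level if `c` is true. -/
noncomputable def row (n : ℕ) {d₂ : ℕ} (c : Bool) (p : RowIdx d₂) : Fin n → ℂ :=
  pair n (2 * p.1 + c.toNat) p.2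

/-- All the states of `mixedStates`, indexed. -/
noncomputable def tileState (m n : ℕ) {d₁ d₂ : ℕ} :
    (Bool × ColIdx d₁) ⊕ (Bool × RowIdx d₂) → State m n
  | .inl (c, p) => prodState (col m c p) (ket n (bif c then 0 else n - 1))
  | .inr (c, p) => prodState (ket m (bif c then m - 1 else 0)) (row n c p)

theorem range_tileState (m n d₁ d₂ : ℕ) :
    Set.range (tileState m n (d₁ := d₁) (d₂ := d₂)) = mixedStates m n d₁ d₂ := by
  ext ψ
  simp only [mixedStates, Set.mem_union, Set.mem_ofPred_eq, Set.mem_range]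
  constructor
  · rintro ⟨⟨_ | _, t | ⟨σ, s⟩⟩ | ⟨_ | _, δ, s⟩, rfl⟩
    · exact .inl <| .inl <| .inl <| .inl <| .inr ⟨t, t.2, rfl⟩
    · exact .inl <| .inl <| .inl <| .inr ⟨σ, by omega, s, rfl⟩
    · exact .inl <| .inr ⟨t, t.2, rfl⟩
    · exact .inr ⟨σ, by omega, s, rfl⟩
    · exact .inl <| .inl <| .inl <| .inl <| .inl ⟨δ, δ.2, s, rfl⟩
    · exact .inl <| .inl <| .inr ⟨δ, δ.2, s, rfl⟩
  · rintro (((((⟨δ, hδ, s, rfl⟩ | ⟨t, ht, rfl⟩) | ⟨σ, hσ, s, rfl⟩) | ⟨δ, hδ, s, rfl⟩) |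
      ⟨t, ht, rfl⟩) | ⟨σ, hσ, s, rfl⟩)
    · exact ⟨.inr (false, ⟨δ, hδ⟩, s), rfl⟩
    · exact ⟨.inl (false, .inl ⟨t, ht⟩), rfl⟩
    · exact ⟨.inl (false, .inr (⟨σ, by omega⟩, s)), rfl⟩
    · exact ⟨.inr (true, ⟨δ, hδ⟩, s), rfl⟩
    · exact ⟨.inl (true, .inl ⟨t, ht⟩), rfl⟩
    · exact ⟨.inl (true, .inr (⟨σ, by omega⟩, s)), rfl⟩

/-! ### Orthogonality of the local parts. -/

section Orthogonality

variable {d k l : ℕ}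

theorem form_pair (E : Matrix (Fin d) (Fin d) ℂ) (s s' : ℤˣ) : form E (pair d k s) (pair d l s') =
    form E (ket d k) (ket d l) + (s' : ℤ) * form E (ket d k) (ket d (l + 1)) +
      (s : ℤ) * (form E (ket d (k + 1)) (ket d l) +
        (s' : ℤ) * form E (ket d (k + 1)) (ket d (l + 1))) := by
  simp [pair]
  ring

theorem form_one_pair_self (hk : k + 1 < d) {s s' : ℤˣ} (h : s ≠ s') :
    form 1 (pair d k s) (pair d k s') = 0 := by
  rw [form_pair, form_one_ket, form_one_ket, form_one_ket, form_one_ket] <;> try omega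
  rcases Int.units_eq_one_or s with rfl | rfl <;> rcases Int.units_eq_one_or s' with rfl | rfl <;>
    simp at h ⊢

theorem form_one_pair_of_ne (hk : k + 1 < d) (hl : l + 1 < d) (h1 : k ≠ l) (h2 : k + 1 ≠ l)
    (h3 : k ≠ l + 1) (s s' : ℤˣ) : form 1 (pair d k s) (pair d l s') = 0 := by
  rw [form_pair, form_one_ket, form_one_ket, form_one_ket, form_one_ket] <;> try omega
  simp [h1, h2, h3]

theorem form_one_triple_pair (hk : k + 2 < d) (hl : l + 1 < d) (h : k + 2 < l) (t : ℕ) (s : ℤˣ) :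
    form 1 (triple d k t) (pair d l s) = 0 := by
  simp only [triple_eq, pair, form_add_left, form_add_right, form_smul_left, form_smul_right]
  rw [form_one_ket, form_one_ket, form_one_ket, form_one_ket, form_one_ket, form_one_ket] <;>
    try omega
  simp (disch := omega) [if_neg]

theorem form_one_triple {t u : ℕ} (hk : k + 2 < d) (ht : t < 3) (hu : u < 3) (h : t ≠ u) :
    form 1 (triple d k t) (triple d k u) = 0 := by
  have hω := one_add_omega_add_sq
  simp only [triple_eq, form_add_left, form_add_right, form_smul_left, form_smul_right, star_pow,
    star_omega]
  simp (disch := omega) only [form_one_ket]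
  simp
  interval_cases t <;> interval_cases u <;> first | exact absurd rfl h | grind

theorem form_one_col {m d₁ : ℕ} (hm : m = 2 * d₁) (hm4 : 4 ≤ m) (c : Bool) {p q : ColIdx d₁}
    (h : p ≠ q) : form 1 (col m c p) (col m c q) = 0 := by
  have hc := c.toNat_le
  rcases p with t | ⟨σ, s⟩ <;> rcases q with u | ⟨τ, s'⟩
  · exact form_one_triple (by omega) t.2 u.2 fun e => h (by rw [Fin.ext e])
  · exact form_one_triple_pair (by omega) (by omega) (by omega) _ _
  · rw [form_one_comm, col, col, form_one_triple_pair (by omega) (by omega) (by omega), star_zero]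
  · rcases eq_or_ne σ τ with rfl | hne
    · exact form_one_pair_self (by omega) fun e => h (by rw [e])
    · have := Fin.val_ne_of_ne hne
      exact form_one_pair_of_ne (by omega) (by omega) (by omega) (by omega) (by omega) _ _

theorem form_one_row {n d₂ : ℕ} (hn : n = 2 * d₂ + 1) (c : Bool) {p q : RowIdx d₂} (h : p ≠ q) :
    form 1 (row n c p) (row n c q) = 0 := by
  have hc := c.toNat_le
  obtain ⟨δ, s⟩ := p
  obtain ⟨ε, s'⟩ := q
  rcases eq_or_ne δ ε with rfl | hne
  · exact form_one_pair_self (by dsimp only; omega) fun e => h (congrArg (Prod.mk δ) e)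
  · have := Fin.val_ne_of_ne hne
    exact form_one_pair_of_ne (by dsimp only; omega) (by dsimp only; omega) (by dsimp only; omega)
      (by dsimp only; omega) (by dsimp only; omega) _ _

/-- The column shifted by `c` misses one of the two extreme levels. -/
theorem form_one_ket_col {m d₁ : ℕ} (hm : m = 2 * d₁) (hm4 : 4 ≤ m) (c : Bool) (p : ColIdx d₁) :
    form 1 (ket m (bif c then 0 else m - 1)) (col m c p) = 0 := by
  rcases p with t | ⟨σ, s⟩ <;> cases c <;>
    simp only [col, triple_eq, pair, form_add_right, form_smul_right, Bool.toNat_false,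
      Bool.toNat_true, cond_true, cond_false] <;>
    simp (disch := omega) [form_one_ket, if_neg]

/-- The row shifted by `c` misses one of the two extreme levels. -/
theorem form_one_ket_row {n d₂ : ℕ} (hn : n = 2 * d₂ + 1) (c : Bool) (p : RowIdx d₂) :
    form 1 (ket n (bif c then 0 else n - 1)) (row n c p) = 0 := by
  obtain ⟨δ, s⟩ := p
  cases c <;>
    simp only [row, pair, form_add_right, form_smul_right, Bool.toNat_false,
      Bool.toNat_true, cond_true, cond_false] <;>
    simp (disch := omega) [form_one_ket, if_neg]

end Orthogonality

/-! ### Orthogonality, product form and number of the states. -/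

section States

variable {m n d₁ d₂ : ℕ}

theorem tileState_orthogonal (hm : m = 2 * d₁) (hm4 : 4 ≤ m) (hn : n = 2 * d₂ + 1) (hn3 : 3 ≤ n)
    {i j : (Bool × ColIdx d₁) ⊕ (Bool × RowIdx d₂)} (h : i ≠ j) :
    star (tileState m n i) ⬝ᵥ tileState m n j = 0 := by
  have key : ∀ (x x' : Fin m → ℂ) (y y' : Fin n → ℂ),
      star (prodState x y) ⬝ᵥ prodState x' y' = form 1 x x' * form 1 y y' := fun x x' y y' => by
    rw [← form_kronecker, one_kronecker_one, one_mulVec]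
  have hcr : ∀ (c c' : Bool) (p : ColIdx d₁) (q : RowIdx d₂),
      form 1 (col m c p) (ket m (bif c' then m - 1 else 0)) *
        form 1 (ket n (bif c then 0 else n - 1)) (row n c' q) = 0 := by
    intro c c' p q
    -- With equal flags Bob's parts are orthogonal, because the row misses the column's level; with
    -- opposite flags Alice's are, because the column misses the row's level.
    rcases eq_or_ne c c' with rfl | hc
    · rw [form_one_ket_row hn, mul_zero]
    · obtain rfl : c' = !c := by cases c <;> cases c' <;> simp at hc ⊢
      have := form_one_ket_col hm hm4 c p
      rw [form_one_comm]
      cases c <;> simp_all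
  rcases i with ⟨c, p⟩ | ⟨c, p⟩ <;> rcases j with ⟨c', q⟩ | ⟨c', q⟩ <;> rw [tileState, tileState, key]
  · rcases eq_or_ne c c' with rfl | hc
    · rw [form_one_col hm hm4 c (by rintro rfl; exact h rfl), zero_mul]
    · refine mul_eq_zero_of_right _ ?_
      cases c <;> cases c' <;> simp (disch := omega) [form_one_ket, if_neg] at hc ⊢
  · exact hcr _ _ _ _
  · rw [form_one_comm, form_one_comm (ket n _), ← star_mul', hcr, star_zero]
  · rcases eq_or_ne c c' with rfl | hc
    · rw [form_one_row hn c (p := p) (q := q) (by rintro rfl; exact h rfl), mul_zero]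
    · refine mul_eq_zero_of_left ?_ _
      cases c <;> cases c' <;> simp (disch := omega) [form_one_ket, if_neg] at hc ⊢

theorem ket_ne_zero {d k : ℕ} (hk : k < d) : ket d k ≠ 0 := fun h => by
  simpa [ket] using congrFun h ⟨k, hk⟩

theorem pair_ne_zero {d k : ℕ} (hk : k < d) (s : ℤˣ) : pair d k s ≠ 0 := fun h => by
  simpa [pair, ket] using congrFun h ⟨k, hk⟩

theorem triple_ne_zero {d k : ℕ} (hk : k < d) (t : ℕ) : triple d k t ≠ 0 := fun h => by
  simpa [triple_eq, ket] using congrFun h ⟨k, hk⟩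

theorem tileState_eq_prodState (hm : m = 2 * d₁) (hm4 : 4 ≤ m) (hn : n = 2 * d₂ + 1) (hn3 : 3 ≤ n)
    (i : (Bool × ColIdx d₁) ⊕ (Bool × RowIdx d₂)) :
    ∃ (x : Fin m → ℂ) (y : Fin n → ℂ), x ≠ 0 ∧ y ≠ 0 ∧ tileState m n i = prodState x y := by
  rcases i with ⟨c, t | ⟨σ, s⟩⟩ | ⟨c, δ, s⟩
  · exact ⟨_, _, triple_ne_zero (by have := c.toNat_le; omega) t,
      ket_ne_zero (by cases c <;> simp <;> omega), rfl⟩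
  · exact ⟨_, _, pair_ne_zero (by have := c.toNat_le; omega) s,
      ket_ne_zero (by cases c <;> simp <;> omega), rfl⟩
  · exact ⟨_, _, ket_ne_zero (by cases c <;> simp <;> omega),
      pair_ne_zero (by have := c.toNat_le; dsimp only; omega) s, rfl⟩

theorem prodState_ne_zero {x : Fin m → ℂ} {y : Fin n → ℂ} (hx : x ≠ 0) (hy : y ≠ 0) :
    prodState x y ≠ 0 := fun h => by
  obtain ⟨i, hi⟩ := Function.ne_iff.1 hx
  obtain ⟨j, hj⟩ := Function.ne_iff.1 hy
  exact mul_ne_zero hi hj (congrFun h (i, j))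

theorem tileState_ne_zero (hm : m = 2 * d₁) (hm4 : 4 ≤ m) (hn : n = 2 * d₂ + 1) (hn3 : 3 ≤ n)
    (i : (Bool × ColIdx d₁) ⊕ (Bool × RowIdx d₂)) : tileState m n i ≠ 0 := by
  obtain ⟨x, y, hx, hy, h⟩ := tileState_eq_prodState hm hm4 hn hn3 i
  exact h ▸ prodState_ne_zero hx hy

/-- Two indices with the same state would make a nonzero vector orthogonal to itself. -/
theorem tileState_injective (hm : m = 2 * d₁) (hm4 : 4 ≤ m) (hn : n = 2 * d₂ + 1) (hn3 : 3 ≤ n) :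
    Function.Injective (tileState m n (d₁ := d₁) (d₂ := d₂)) := fun i j h => by
  by_contra hne
  have := tileState_orthogonal hm hm4 hn hn3 hne
  rw [← h] at this
  have hpos := normSq_pos (tileState_ne_zero hm hm4 hn hn3 i)
  rw [normSq_eq, this] at hpos
  simp at hpos

theorem ncard_mixedStates (hm : m = 2 * d₁) (hm4 : 4 ≤ m) (hn : n = 2 * d₂ + 1) (hn3 : 3 ≤ n) :
    (mixedStates m n d₁ d₂).ncard = 2 * (m + n) - 4 := by
  rw [← range_tileState, ← Set.image_univ,
    Set.ncard_image_of_injective _ (tileState_injective hm hm4 hn hn3), Set.ncard_univ]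
  simp only [Nat.card_eq_fintype_card, Fintype.card_sum, Fintype.card_prod, Fintype.card_bool,
    Fintype.card_fin, Fintype.card_units_int]
  omega

end States

/-! ### Block decomposition of the levels. -/

section Blocks

variable {m n d₁ d₂ : ℕ}

/-- The number of the block of levels on which a vector of a column is supported. -/
def colBlock : ColIdx d₁ → ℕ
  | .inl _ => 0
  | .inr (σ, _) => σ + 1

/-- The number of the block of the unshifted column that contains the level `i`. -/
def levelBlock (i : ℕ) : ℕ := if i < 3 then 0 else (i - 1) / 2

/-- Recording the block, and not only membership in the span of the column, is what makes levels in
different blocks come from distinct states. -/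
theorem ket_mem_span_col (hm : m = 2 * d₁) {c : Bool} {k : ℕ} (hk : c.toNat ≤ k)
    (hk' : k + 1 < m + c.toNat) : ket m k ∈ Submodule.span ℂ
      {x | ∃ p : ColIdx d₁, colBlock p = levelBlock (k - c.toNat) ∧ x = col m c p} := by
  obtain ⟨i, rfl⟩ := Nat.exists_eq_add_of_le hk
  rw [Nat.add_sub_cancel_left]
  by_cases hi : i < 3
  · refine Submodule.span_mono ?_ (ket_mem_span_triple m c.toNat i hi)
    rintro _ ⟨t, ht, rfl⟩
    exact ⟨.inl ⟨t, ht⟩, by simp [colBlock, levelBlock, hi], rfl⟩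
  · have h := ket_mem_span_pair m (2 * ((i - 3) / 2) + 3 + c.toNat) ((i - 3) % 2)
      (Nat.mod_lt _ (by norm_num))
    have e : 2 * ((i - 3) / 2) + 3 + c.toNat + (i - 3) % 2 = c.toNat + i := by omega
    rw [e] at h
    refine Submodule.span_mono ?_ h
    rintro _ ⟨s, rfl⟩
    refine ⟨.inr (⟨(i - 3) / 2, by omega⟩, s), ?_, rfl⟩
    simp only [colBlock, levelBlock, hi, if_false]
    omega

theorem ket_mem_span_row (hn : n = 2 * d₂ + 1) {c : Bool} {k : ℕ} (hk : c.toNat ≤ k)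
    (hk' : k + 1 < n + c.toNat) : ket n k ∈ Submodule.span ℂ
      {x | ∃ p : RowIdx d₂, (p.1 : ℕ) = (k - c.toNat) / 2 ∧ x = row n c p} := by
  obtain ⟨i, rfl⟩ := Nat.exists_eq_add_of_le hk
  rw [Nat.add_sub_cancel_left]
  have h := ket_mem_span_pair n (2 * (i / 2) + c.toNat) (i % 2) (Nat.mod_lt _ (by norm_num))
  have e : 2 * (i / 2) + c.toNat + i % 2 = c.toNat + i := by omega
  rw [e] at h
  refine Submodule.span_mono ?_ h
  rintro _ ⟨s, rfl⟩
  exact ⟨(⟨i / 2, by omega⟩, s), rfl, rfl⟩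

end Blocks

/-! ### Consequences of orthogonality inside one tile. -/

section Scalar

variable {d : ℕ} {E : Matrix (Fin d) (Fin d) ℂ} {k : ℕ}

/-- Without cross terms, the form between the sum and the difference is the difference of the two
diagonal entries. -/
theorem form_ket_eq_of_pair (h0 : form E (ket d k) (ket d (k + 1)) = 0)
    (h1 : form E (ket d (k + 1)) (ket d k) = 0)
    (h : form E (pair d k 1) (pair d k (-1)) = 0) :
    form E (ket d k) (ket d k) = form E (ket d (k + 1)) (ket d (k + 1)) := by
  rw [form_pair, h0, h1] at h
  push_cast [Units.val_neg, Units.val_one] at h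
  linear_combination h

/-- Write `x, p, q` for the diagonal entries and `r, s` for the two unknown cross terms. For fixed
`u - t` modulo 3, the relation is a constant plus multiples of `r` and `s` by opposite nontrivial
characters of `t`. Varying `t` gives `r = s = 0`, and the constants for `u - t = 1, 2` then force `x
= p = q`. -/
theorem form_ket_of_triple (h : ∀ t < 3, ∀ u < 3, t ≠ u → form E (triple d k t) (triple d k u) = 0)
    (h1 : form E (ket d k) (ket d (k + 1)) = 0) (h1' : form E (ket d (k + 1)) (ket d k) = 0)
    (h2 : form E (ket d k) (ket d (k + 2)) = 0) (h2' : form E (ket d (k + 2)) (ket d k) = 0) :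
    form E (ket d (k + 1)) (ket d (k + 2)) = 0 ∧ form E (ket d (k + 2)) (ket d (k + 1)) = 0 ∧
      form E (ket d k) (ket d k) = form E (ket d (k + 1)) (ket d (k + 1)) ∧
      form E (ket d (k + 1)) (ket d (k + 1)) = form E (ket d (k + 2)) (ket d (k + 2)) := by
  have hω := one_add_omega_add_sq
  have h01 := h 0 (by norm_num) 1 (by norm_num) (by norm_num)
  have h12 := h 1 (by norm_num) 2 (by norm_num) (by norm_num)
  have h20 := h 2 (by norm_num) 0 (by norm_num) (by norm_num)
  have h10 := h 1 (by norm_num) 0 (by norm_num) (by norm_num)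
  have h21 := h 2 (by norm_num) 1 (by norm_num) (by norm_num)
  have h02 := h 0 (by norm_num) 2 (by norm_num) (by norm_num)
  simp only [triple_eq, form_add_left, form_add_right, form_smul_left, form_smul_right, star_pow,
    star_omega, h1, h1', h2, h2'] at h01 h12 h20 h10 h21 h02
  generalize form E (ket d k) (ket d k) = x at *
  generalize form E (ket d (k + 1)) (ket d (k + 1)) = p at *
  generalize form E (ket d (k + 2)) (ket d (k + 2)) = q at *
  generalize form E (ket d (k + 1)) (ket d (k + 2)) = r at *
  generalize form E (ket d (k + 2)) (ket d (k + 1)) = s at *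
  generalize ω = w at *
  clear h h1 h1' h2 h2'
  refine ⟨?_, ?_, ?_, ?_⟩ <;> grind

end Scalar

/-! ### Local stability of the set of states. -/

section Stable

variable {m n d₁ d₂ : ℕ}

theorem alice_scalar (hm : m = 2 * d₁) (hm4 : 4 ≤ m) (hn : n = 2 * d₂ + 1) (hn3 : 3 ≤ n)
    {E : Matrix (Fin m) (Fin m) ℂ} (h : ∀ i j : (Bool × ColIdx d₁) ⊕ (Bool × RowIdx d₂), i ≠ j →
      star (tileState m n i) ⬝ᵥ ((E ⊗ₖ (1 : Matrix (Fin n) (Fin n) ℂ)) *ᵥ tileState m n j) = 0) :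
    ∃ c : ℂ, E = c • 1 := by
  have hcol : ∀ (c : Bool) (p q : ColIdx d₁), p ≠ q → form E (col m c p) (col m c q) = 0 := by
    intro c p q hpq
    have := h (.inl (c, p)) (.inl (c, q)) (by simpa using hpq)
    rw [tileState, tileState, form_kronecker,
      form_one_ket (by cases c <;> simp <;> omega) (by cases c <;> simp <;> omega)] at this
    simpa using this
  -- The row with the opposite flag reaches Bob's level of column `c`, so the Bob factor can be
  -- cancelled; Alice's level of that row is the one that column `c` omits.
  have hoverlap : ∀ c : Bool, ∃ q : RowIdx d₂,
      form 1 (row n (!c) q) (ket n (bif c then 0 else n - 1)) ≠ 0 := by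
    rintro (_ | _)
    · refine ⟨(⟨d₂ - 1, by omega⟩, 1), ?_⟩
      simp only [row, pair, form_add_left, form_smul_left, cond_false, Bool.not_false,
        Bool.toNat_true]
      simp (disch := omega) [form_one_ket, if_neg, if_pos]
    · refine ⟨(⟨0, by omega⟩, 1), ?_⟩
      simp only [row, pair, form_add_left, form_smul_left, cond_true, Bool.not_true,
        Bool.toNat_false]
      simp (disch := omega) [form_one_ket]
  have hend : ∀ (c : Bool) (p : ColIdx d₁),
      form E (ket m (bif c then 0 else m - 1)) (col m c p) = 0 ∧
        form E (col m c p) (ket m (bif c then 0 else m - 1)) = 0 := by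
    intro c p
    obtain ⟨q, hq⟩ := hoverlap c
    have hket : (bif !c then m - 1 else 0) = bif c then 0 else m - 1 := by cases c <;> rfl
    have h1 := h (.inr (!c, q)) (.inl (c, p)) (by simp)
    have h2 := h (.inl (c, p)) (.inr (!c, q)) (by simp)
    rw [tileState, tileState, form_kronecker, hket] at h1 h2
    refine ⟨(mul_eq_zero.1 h1).resolve_right hq, (mul_eq_zero.1 h2).resolve_right ?_⟩
    rw [form_one_comm]
    exact star_ne_zero.2 hq
  have hends : ∀ (c : Bool) (k : ℕ), c.toNat ≤ k → k + 1 < m + c.toNat →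
      form E (ket m (bif c then 0 else m - 1)) (ket m k) = 0 ∧
        form E (ket m k) (ket m (bif c then 0 else m - 1)) = 0 := by
    intro c k hk hk'
    have hs := ket_mem_span_col hm hk hk'
    have he := Submodule.mem_span_singleton_self (R := ℂ) (ket m (bif c then 0 else m - 1))
    constructor
    · refine form_eq_zero_of_mem_span E ?_ he hs
      rintro _ rfl _ ⟨p, -, rfl⟩
      exact (hend c p).1
    · refine form_eq_zero_of_mem_span E ?_ hs he
      rintro _ ⟨p, -, rfl⟩ _ rfl
      exact (hend c p).2
  have hblock : ∀ (c : Bool) (k l : ℕ), c.toNat ≤ k → k + 1 < m + c.toNat → c.toNat ≤ l →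
      l + 1 < m + c.toNat → levelBlock (k - c.toNat) ≠ levelBlock (l - c.toNat) →
      form E (ket m k) (ket m l) = 0 := by
    intro c k l hk hk' hl hl' hkl
    refine form_eq_zero_of_mem_span E ?_ (ket_mem_span_col hm hk hk') (ket_mem_span_col hm hl hl')
    rintro _ ⟨p, hp, rfl⟩ _ ⟨q, hq, rfl⟩
    exact hcol c p q (by rintro rfl; exact hkl (hp.symm.trans hq))
  have htriple : ∀ c : Bool, ∀ t < 3, ∀ u < 3, t ≠ u →
      form E (triple m c.toNat t) (triple m c.toNat u) = 0 := fun c t ht u hu htu =>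
    hcol c (.inl ⟨t, ht⟩) (.inl ⟨u, hu⟩) (by simpa using htu)
  have hzero : ∀ k, 0 < k → k < m →
      form E (ket m 0) (ket m k) = 0 ∧ form E (ket m k) (ket m 0) = 0 := fun k hk hk' =>
    hends true k (Nat.succ_le_of_lt hk) (by simpa using hk')
  have hlast : ∀ k, k + 1 < m →
      form E (ket m (m - 1)) (ket m k) = 0 ∧ form E (ket m k) (ket m (m - 1)) = 0 := fun k hk =>
    hends false k (by simp) (by simpa using hk)
  -- Level 0 is already decoupled from levels 1 and 2 by the shifted column, as the triple lemma
  -- requires.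
  obtain ⟨h12, h21, d01, d12⟩ := form_ket_of_triple (htriple false)
    (hzero 1 (by omega) (by omega)).1 (hzero 1 (by omega) (by omega)).2
    (hzero 2 (by omega) (by omega)).1 (hzero 2 (by omega) (by omega)).2
  have hoff : ∀ k < m, ∀ l < m, k ≠ l → form E (ket m k) (ket m l) = 0 := by
    intro k hk l hl hkl
    rcases Nat.eq_zero_or_pos k with rfl | hk0
    · exact (hzero l (by omega) hl).1
    rcases Nat.eq_zero_or_pos l with rfl | hl0
    · exact (hzero k (by omega) hk).2
    by_cases hk1 : k = m - 1
    · rw [hk1]; exact (hlast l (by omega)).1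
    by_cases hl1 : l = m - 1
    · rw [hl1]; exact (hlast k (by omega)).2
    by_cases hb0 : levelBlock k = levelBlock l
    · by_cases hb1 : levelBlock (k - 1) = levelBlock (l - 1)
      · have : (k = 1 ∧ l = 2) ∨ (k = 2 ∧ l = 1) := by
          unfold levelBlock at hb0 hb1
          split_ifs at hb0 hb1 <;> omega
        rcases this with ⟨rfl, rfl⟩ | ⟨rfl, rfl⟩
        exacts [h12, h21]
      · exact hblock true k l hk0 (by simpa) hl0 (by simpa) (by simpa)
    · exact hblock false k l (by simp) (by simp; omega) (by simp) (by simp; omega) (by simpa)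
  refine eq_smul_one_of_form_ket E hoff fun k hk => ?_
  have hpair : ∀ (c : Bool) (σ : ℕ), σ + 3 ≤ d₁ → k = 2 * σ + 3 + c.toNat →
      form E (ket m k) (ket m k) = form E (ket m (k + 1)) (ket m (k + 1)) := by
    rintro c σ hσ rfl
    exact form_ket_eq_of_pair (hoff _ (by omega) _ (by omega) (by omega))
      (hoff _ (by omega) _ (by omega) (by omega))
      (hcol c (.inr (⟨σ, by omega⟩, 1)) (.inr (⟨σ, by omega⟩, -1)) (by simp))
  -- The two triples link the diagonal entries at levels 0 to 3; beyond that, odd `k` starts an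
  -- unshifted pair and even `k` a shifted one.
  obtain hk3 | hk3 := lt_or_ge k 3
  · obtain ⟨-, -, -, d23⟩ := form_ket_of_triple (htriple true)
      (hoff 1 (by omega) 2 (by omega) (by omega)) (hoff 2 (by omega) 1 (by omega) (by omega))
      (hoff 1 (by omega) 3 (by omega) (by omega)) (hoff 3 (by omega) 1 (by omega) (by omega))
    interval_cases k
    exacts [d01, d12, d23]
  · rcases Nat.even_or_odd' k with ⟨j, rfl | rfl⟩
    · exact hpair true (j - 2) (by omega) (by simp; omega)
    · exact hpair false (j - 1) (by omega) (by simp; omega)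

theorem bob_scalar (hm : m = 2 * d₁) (hm4 : 4 ≤ m) (hn : n = 2 * d₂ + 1) (hn3 : 3 ≤ n)
    {F : Matrix (Fin n) (Fin n) ℂ} (h : ∀ i j : (Bool × ColIdx d₁) ⊕ (Bool × RowIdx d₂), i ≠ j →
      star (tileState m n i) ⬝ᵥ (((1 : Matrix (Fin m) (Fin m) ℂ) ⊗ₖ F) *ᵥ tileState m n j) = 0) :
    ∃ c : ℂ, F = c • 1 := by
  have hrow : ∀ (c : Bool) (p q : RowIdx d₂), p ≠ q → form F (row n c p) (row n c q) = 0 := by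
    intro c p q hpq
    have := h (.inr (c, p)) (.inr (c, q)) (by simpa using hpq)
    rw [tileState, tileState, form_kronecker,
      form_one_ket (by cases c <;> simp <;> omega) (by cases c <;> simp <;> omega)] at this
    simpa using this
  -- Here equal flags are matched: column `c` reaches Alice's level of row `c`, and sits at the Bob
  -- level which that row omits.
  have hoverlap : ∀ c : Bool, ∃ q : ColIdx d₁,
      form 1 (col m c q) (ket m (bif c then m - 1 else 0)) ≠ 0 := by
    rintro (_ | _)
    · refine ⟨.inl 0, ?_⟩
      simp only [col, triple_eq, form_add_left, form_smul_left, cond_false, Bool.toNat_false]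
      simp (disch := omega) [form_one_ket]
    -- Alice's last level lies in the shifted triple if `d₁ = 2`, and in the last shifted pair, `σ =
    -- d₁ - 3`, otherwise.
    · obtain rfl | hd := eq_or_ne d₁ 2
      · refine ⟨.inl 0, ?_⟩
        subst hm
        simp only [col, triple_eq, form_add_left, form_smul_left, cond_true, Bool.toNat_true]
        simp (disch := omega) [form_one_ket]
      · refine ⟨.inr (⟨d₁ - 3, by omega⟩, 1), ?_⟩
        simp only [col, pair, form_add_left, form_smul_left, cond_true, Bool.toNat_true]
        simp (disch := omega) [form_one_ket, if_neg, if_pos]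
  have hend : ∀ (c : Bool) (p : RowIdx d₂),
      form F (ket n (bif c then 0 else n - 1)) (row n c p) = 0 ∧
        form F (row n c p) (ket n (bif c then 0 else n - 1)) = 0 := by
    intro c p
    obtain ⟨q, hq⟩ := hoverlap c
    have h1 := h (.inl (c, q)) (.inr (c, p)) (by simp)
    have h2 := h (.inr (c, p)) (.inl (c, q)) (by simp)
    rw [tileState, tileState, form_kronecker] at h1 h2
    refine ⟨(mul_eq_zero.1 h1).resolve_left hq, (mul_eq_zero.1 h2).resolve_left ?_⟩
    rw [form_one_comm]
    exact star_ne_zero.2 hq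
  have hends : ∀ (c : Bool) (k : ℕ), c.toNat ≤ k → k + 1 < n + c.toNat →
      form F (ket n (bif c then 0 else n - 1)) (ket n k) = 0 ∧
        form F (ket n k) (ket n (bif c then 0 else n - 1)) = 0 := by
    intro c k hk hk'
    have hs := ket_mem_span_row hn hk hk'
    have he := Submodule.mem_span_singleton_self (R := ℂ) (ket n (bif c then 0 else n - 1))
    constructor
    · refine form_eq_zero_of_mem_span F ?_ he hs
      rintro _ rfl _ ⟨p, -, rfl⟩
      exact (hend c p).1
    · refine form_eq_zero_of_mem_span F ?_ hs he
      rintro _ ⟨p, -, rfl⟩ _ rfl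
      exact (hend c p).2
  have hblock : ∀ (c : Bool) (k l : ℕ), c.toNat ≤ k → k + 1 < n + c.toNat → c.toNat ≤ l →
      l + 1 < n + c.toNat → (k - c.toNat) / 2 ≠ (l - c.toNat) / 2 →
      form F (ket n k) (ket n l) = 0 := by
    intro c k l hk hk' hl hl' hkl
    refine form_eq_zero_of_mem_span F ?_ (ket_mem_span_row hn hk hk') (ket_mem_span_row hn hl hl')
    rintro _ ⟨p, hp, rfl⟩ _ ⟨q, hq, rfl⟩
    exact hrow c p q (by rintro rfl; exact hkl (hp.symm.trans hq))
  have hoff : ∀ k < n, ∀ l < n, k ≠ l → form F (ket n k) (ket n l) = 0 := by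
    intro k hk l hl hkl
    rcases Nat.eq_zero_or_pos k with rfl | hk0
    · exact (hends true l (by simp; omega) (by simpa)).1
    rcases Nat.eq_zero_or_pos l with rfl | hl0
    · exact (hends true k (by simp; omega) (by simpa)).2
    by_cases hk1 : k = n - 1
    · rw [hk1]; exact (hends false l (by simp) (by simp; omega)).1
    by_cases hl1 : l = n - 1
    · rw [hl1]; exact (hends false k (by simp) (by simp; omega)).2
    -- The blocks `{0,1}, {2,3}, …` and `{1,2}, {3,4}, …` have no pair of levels in common, so one
    -- of the two rows always separates `k` from `l`.
    by_cases hb : k / 2 = l / 2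
    · exact hblock true k l hk0 (by simpa) hl0 (by simpa) (by simp; omega)
    · exact hblock false k l (by simp) (by simp; omega) (by simp) (by simp; omega) (by simpa)
  refine eq_smul_one_of_form_ket F hoff fun k hk => ?_
  have hpair : ∀ (c : Bool) (δ : ℕ), δ < d₂ → k = 2 * δ + c.toNat →
      form F (ket n k) (ket n k) = form F (ket n (k + 1)) (ket n (k + 1)) := by
    rintro c δ hδ rfl
    exact form_ket_eq_of_pair (hoff _ (by omega) _ (by omega) (by omega))
      (hoff _ (by omega) _ (by omega) (by omega))
      (hrow c (⟨δ, hδ⟩, 1) (⟨δ, hδ⟩, -1) (by simp))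
  rcases Nat.even_or_odd' k with ⟨j, rfl | rfl⟩
  · exact hpair false j (by omega) rfl
  · exact hpair true j (by omega) rfl

theorem locallyStable_mixedStates (hm : m = 2 * d₁) (hm4 : 4 ≤ m) (hn : n = 2 * d₂ + 1)
    (hn3 : 3 ≤ n) : LocallyStable (mixedStates m n d₁ d₂) := by
  have hinj := tileState_injective (d₁ := d₁) (d₂ := d₂) hm hm4 hn hn3
  rw [← range_tileState]
  exact ⟨fun E hE => alice_scalar hm hm4 hn hn3 fun i j hij => hE ⟨i, rfl⟩ ⟨j, rfl⟩ (hinj.ne hij),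
    fun F hF => bob_scalar hm hm4 hn hn3 fun i j hij => hF ⟨i, rfl⟩ ⟨j, rfl⟩ (hinj.ne hij)⟩

end Stable

end LOCC

theorem theorem6 (m n d₁ d₂ : ℕ) (hm : m = 2 * d₁) (hm4 : 4 ≤ m) (hn : n = 2 * d₂ + 1)
    (hn3 : 3 ≤ n) :
    (LOCC.mixedStates m n d₁ d₂).ncard = 2 * (m + n) - 4 ∧
    (∀ ψ ∈ LOCC.mixedStates m n d₁ d₂,
      ∃ (x : Fin m → ℂ) (y : Fin n → ℂ), x ≠ 0 ∧ y ≠ 0 ∧ ψ = LOCC.prodState x y) ∧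
    (LOCC.mixedStates m n d₁ d₂).Pairwise (fun ψ φ => star ψ ⬝ᵥ φ = 0) ∧
    ¬ LOCC.PerfectlyDistinguishable (LOCC.mixedStates m n d₁ d₂) := by
  have hcard := LOCC.ncard_mixedStates hm hm4 hn hn3
  refine ⟨hcard, ?_, ?_,
    (LOCC.locallyStable_mixedStates hm hm4 hn hn3).not_perfectlyDistinguishable ?_ ?_⟩
  · rw [← LOCC.range_tileState]
    rintro _ ⟨i, rfl⟩
    exact LOCC.tileState_eq_prodState hm hm4 hn hn3 i
  · rw [← LOCC.range_tileState]
    rintro _ ⟨i, rfl⟩ _ ⟨j, rfl⟩ hij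
    exact LOCC.tileState_orthogonal hm hm4 hn hn3 (by rintro rfl; exact hij rfl)
  · rw [← LOCC.range_tileState]
    rintro _ ⟨i, rfl⟩
    exact LOCC.tileState_ne_zero hm hm4 hn hn3 i
  · exact (Set.one_lt_ncard_iff_nontrivial_and_finite.1 (by omega)).1
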